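/- Let $d,k\ge 1$ be integers and let $(s_i)_{i\ge 1}$ be the Sylvester sequence, $s_1=2$ and $s_i=1+s_1s_2\cdots s_{i-1}$ for $i\ge 2$. A lattice polytope in $\mathbb{R}^d$ is a polytope all of whose vertices belong to $\mathbb{Z}^d$. Let $\mathcal{P}^d(k)$ be the family of all $d$-dimensional lattice polytopes in $\mathbb{R}^d$ whose interior contains exactly $k$ points of $\mathbb{Z}^d$, and let $p(d,k)\in[0,\infty]$ be the supremum of the Euclidean volumes $\operatorname{vol}(P)$ over $P\in\mathcal{P}^d(k)$. Then: (a) For every simplex $S\in\mathcal{P}^d(k)$ there exists a point of $\mathbb{Z}^d$ in the interior of $S$ all of whose barycentric coordinates with respect to the vertices of $S$ are at least $\dfrac{1}{(d+1)(s_{d+1}-1)}$. (b) $p(d,k)\le \bigl(d\,(2d+1)\,(s_{2d+1}-1)\bigr)^d\,k$. -/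

import Mathlib

open scoped ENNReal

/-- The Sylvester sequence `s₁ = 2`, `sᵢ = 1 + s₁ ⋯ sᵢ₋₁` for `i ≥ 2`, i.e. `2, 3, 7, 43, …`.
The index starts at `1`; the filler value at index `0` is `1`, so that it does not affect the
products (see `sylvester_one` and `sylvester_of_two_le`). -/
def sylvester : ℕ → ℕ
  | 0 => 1
  | n + 1 => 1 + ∏ j : Fin (n + 1), sylvester j
decreasing_by exact j.isLt

theorem sylvester_one : sylvester 1 = 2 := by
  simp [sylvester]

theorem sylvester_of_two_le (i : ℕ) (hi : 2 ≤ i) :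
    sylvester i = 1 + ∏ j ∈ Finset.Ico 1 i, sylvester j := by
  obtain ⟨n, rfl⟩ : ∃ n, i = n + 1 := ⟨i - 1, by omega⟩
  rw [sylvester, Fin.prod_univ_eq_prod_range (fun j => sylvester j) (n + 1),
    Finset.prod_range_eq_mul_Ico _ (Nat.succ_pos n)]
  simp [sylvester]

/-- The lattice `ℤ^d`, as a subset of `ℝ^d`. The space `Fin d → ℝ` is used only through its affine
structure, its topology and its Lebesgue measure `volume`, i.e. the Euclidean volume. -/
def latticePoints (d : ℕ) : Set (Fin d → ℝ) :=
  Set.range fun (z : Fin d → ℤ) (i : Fin d) => (z i : ℝ)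

/-- A polytope in `ℝ^d`: the convex hull of a finite set of points. -/
def IsPolytope {d : ℕ} (P : Set (Fin d → ℝ)) : Prop :=
  ∃ F : Set (Fin d → ℝ), F.Finite ∧ P = convexHull ℝ F

/-- A lattice polytope: a polytope all of whose vertices belong to `ℤ^d`. -/
def IsLatticePolytope {d : ℕ} (P : Set (Fin d → ℝ)) : Prop :=
  IsPolytope P ∧ P.extremePoints ℝ ⊆ latticePoints d

/-- The family of all `d`-dimensional lattice polytopes in `ℝ^d` that have exactly `k` interior
lattice points. -/
def latticePolytopes (d k : ℕ) : Set (Set (Fin d → ℝ)) :=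
  {P | IsLatticePolytope P ∧ affineSpan ℝ P = ⊤ ∧
    (interior P ∩ latticePoints d).encard = (k : ℕ∞)}

/-- The family of all simplices among the `d`-dimensional lattice polytopes in `ℝ^d` with exactly
`k` interior lattice points. A `d`-dimensional simplex is the convex hull of `d + 1` affinely
independent points of `ℝ^d`, that is, of the points of an affine basis. -/
def latticeSimplices (d k : ℕ) : Set (Set (Fin d → ℝ)) :=
  {S | S ∈ latticePolytopes d k ∧
    ∃ b : AffineBasis (Fin (d + 1)) ℝ (Fin d → ℝ), S = convexHull ℝ (Set.range b)}

/-- `p(d, k)`: the largest volume of a `d`-dimensional lattice polytope in `ℝ^d` with exactly `k`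
interior lattice points, as a supremum in `[0, ∞]`; a bound `p(d, k) ≤ c` with `c < ∞` thus contains
the finiteness of `p(d, k)`. -/
noncomputable def maxVolume (d k : ℕ) : ℝ≥0∞ :=
  ⨆ P ∈ latticePolytopes d k, MeasureTheory.volume P

/-! Write an interior lattice point as a positive convex combination of lattice points. Among the
nonnegative coefficient vectors of sum 1 that produce lattice points, let β have the largest least
coordinate ε. If ∏_J (β_i − ε) > 1 − ∑_J β_i for a proper index set J, Minkowski's linear forms
theorem gives an integer vector q ≠ 0 close to mβ on J, with m = ∑ q > 0 after a sign change, and (m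
+ 1)β − q exceeds ε everywhere (`prod_sub_le_one_sub_sum`). So the sorted numbers β_i − ε satisfy
product-sum inequalities, for which the reciprocals 1/s_i are extremal (`sum_le_sum_inv_sylvester`);
this bounds ε below. Applied to the vertices of a simplex, it gives (a).

For (b), an interior lattice point is a positive combination of at most 2d + 1 vertices, counted
with repetition, of which d + 1 span a simplex of maximal volume. The improved point w has all
coefficients at least 1/N, while every p ∈ P has coefficients at most 1 in that simplex, so N w − p
has nonnegative coefficients (`IsLatticePolytope.exists_asymmetry_le`). If vol P > N^d k,
Blichfeldt's principle for N⁻¹ int P yields more than k lattice points whose differences, shifted by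
w, lie in int P (`volume_le_of_asymmetry`). -/

/-! ### Sylvester numbers and product-sum inequalities -/

theorem sylvester_succ (n : ℕ) :
    sylvester (n + 1) = 1 + ∏ i ∈ Finset.range n, sylvester (i + 1) := by
  rw [sylvester, Fin.prod_univ_eq_prod_range (fun j => sylvester j) (n + 1),
    Finset.prod_range_succ']
  simp [sylvester]

theorem sylvester_pos (n : ℕ) : 0 < sylvester n := by
  cases n <;> simp [sylvester]

theorem one_le_prod_sylvester (n : ℕ) : 1 ≤ ∏ i ∈ Finset.range n, sylvester (i + 1) :=
  Finset.prod_pos fun _ _ => sylvester_pos _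

theorem sylvester_succ_sub_one (n : ℕ) :
    (sylvester (n + 1) : ℝ) - 1 = ∏ i ∈ Finset.range n, (sylvester (i + 1) : ℝ) := by
  rw [sylvester_succ]; push_cast; ring

theorem sylvester_succ_sub_one_pos (n : ℕ) : (0 : ℝ) < (sylvester (n + 1) : ℝ) - 1 := by
  rw [sylvester_succ_sub_one]
  exact Finset.prod_pos fun i _ => by exact_mod_cast sylvester_pos _

theorem sylvester_succ_mono {m n : ℕ} (h : m ≤ n) : sylvester (m + 1) ≤ sylvester (n + 1) := by
  induction n, h using Nat.le_induction with
  | base => exact le_rfl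
  | succ n _ ih =>
    refine ih.trans ?_
    rw [sylvester_succ (n + 1), Finset.prod_range_succ]
    have := Nat.le_mul_of_pos_left (sylvester (n + 1)) (one_le_prod_sylvester n)
    omega

/-- The reciprocals attain equality in every product-sum inequality. -/
theorem sum_inv_sylvester (n : ℕ) :
    1 - ∑ i ∈ Finset.range n, (sylvester (i + 1) : ℝ)⁻¹ =
      ∏ i ∈ Finset.range n, (sylvester (i + 1) : ℝ)⁻¹ := by
  induction n with
  | zero => simp
  | succ n ih =>
    rw [Finset.sum_range_succ, Finset.prod_range_succ, ← sub_sub, ih, Finset.prod_inv_distrib,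
      ← sylvester_succ_sub_one]
    have h1 := (sylvester_succ_sub_one_pos n).ne'
    have h2 : (sylvester (n + 1) : ℝ) ≠ 0 := by exact_mod_cast (sylvester_pos _).ne'
    field_simp
    ring

/-- Summation by parts with increasing weights and nonpositive proper partial sums. -/
theorem mul_sum_le_sum_mul {w δ : ℕ → ℝ} (n : ℕ) (hw : MonotoneOn w (Set.Iic n))
    (hδ : ∀ j ≤ n, ∑ i ∈ Finset.range j, δ i ≤ 0) :
    w n * ∑ i ∈ Finset.range (n + 1), δ i ≤ ∑ i ∈ Finset.range (n + 1), w i * δ i := by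
  induction n with
  | zero => simp
  | succ n ih =>
    have h1 := ih (hw.mono (Set.Iic_subset_Iic.2 n.le_succ)) fun j hj => hδ j (by omega)
    rw [Finset.sum_range_succ, Finset.sum_range_succ _ (n + 1)]
    have h2 := hδ (n + 1) le_rfl
    have h3 : w n ≤ w (n + 1) := hw (by simp) (by simp) n.le_succ
    nlinarith

/-- A nonincreasing sequence satisfying the product-sum inequalities has partial sums bounded by
those of the reciprocals of the Sylvester sequence. -/
theorem sum_le_sum_inv_sylvester {γ : ℕ → ℝ} (n : ℕ) (hγ : AntitoneOn γ (Set.Iio n))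
    (h : ∀ j ≤ n, ∏ i ∈ Finset.range j, γ i ≤ 1 - ∑ i ∈ Finset.range j, γ i) :
    ∑ i ∈ Finset.range n, γ i ≤ ∑ i ∈ Finset.range n, (sylvester (i + 1) : ℝ)⁻¹ := by
  induction n using Nat.strong_induction_on with
  | _ n ih =>
  obtain _ | n := n
  · simp
  by_contra! hlt
  have hpart : ∀ j ≤ n, ∑ i ∈ Finset.range j, (γ i - (sylvester (i + 1) : ℝ)⁻¹) ≤ 0 := by
    intro j hj
    rw [Finset.sum_sub_distrib, sub_nonpos]
    exact ih j (by omega) (hγ.mono (Set.Iio_subset_Iio (by omega))) fun k hk => h k (by omega)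
  have htot : 0 < ∑ i ∈ Finset.range (n + 1), (γ i - (sylvester (i + 1) : ℝ)⁻¹) := by
    rw [Finset.sum_sub_distrib]; linarith
  have hs : ∀ i, (0 : ℝ) < (sylvester (i + 1) : ℝ)⁻¹ := fun i =>
    inv_pos.2 (by exact_mod_cast sylvester_pos _)
  have hn : 0 < γ n := by
    rw [Finset.sum_range_succ] at htot
    linarith [hpart n le_rfl, hs n]
  have hpos : ∀ i ≤ n, 0 < γ i := fun i hi =>
    hn.trans_le (hγ (by simp; omega) (by simp) hi)
  -- The weights 1/γ_i increase because γ decreases, so the positive total of δ_i = γ_i − 1/s_i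
  -- survives the weighting.
  have habel := mul_sum_le_sum_mul (w := fun i => (γ i)⁻¹) n
    (fun i _ j hj hij => inv_anti₀ (hpos j hj)
      (hγ (by simp at *; omega) (by simp at *; omega) hij)) hpart
  have hsum : 0 < ∑ i ∈ Finset.range (n + 1), (γ i)⁻¹ * (γ i - (sylvester (i + 1) : ℝ)⁻¹) :=
    (mul_pos (inv_pos.2 hn) htot).trans_le habel
  have hprod : ∏ i ∈ Finset.range (n + 1), (sylvester (i + 1) : ℝ)⁻¹ <
      ∏ i ∈ Finset.range (n + 1), γ i := by
    -- Each factor equals 1 − δ_i/γ_i ≤ exp(−δ_i/γ_i).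
    have hle : ∏ i ∈ Finset.range (n + 1), ((sylvester (i + 1) : ℝ)⁻¹ / γ i) ≤
        Real.exp (-∑ i ∈ Finset.range (n + 1), (γ i)⁻¹ * (γ i - (sylvester (i + 1) : ℝ)⁻¹)) := by
      rw [← Finset.sum_neg_distrib, Real.exp_sum]
      refine Finset.prod_le_prod (fun i hi => (div_pos (hs i) (hpos i ?_)).le) fun i hi => ?_
      · simp at hi; omega
      · have hi' : γ i ≠ 0 := (hpos i (by simp at hi; omega)).ne'
        refine le_of_eq_of_le ?_ (Real.add_one_le_exp _)
        field_simp
        ring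
    rw [Finset.prod_div_distrib] at hle
    have hP : 0 < ∏ i ∈ Finset.range (n + 1), γ i :=
      Finset.prod_pos fun i hi => hpos i (by simp at hi; omega)
    rw [← div_lt_one hP]
    exact hle.trans_lt (Real.exp_lt_one_iff.2 (neg_neg_of_pos hsum))
  have h1 := h (n + 1) le_rfl
  have h2 := sum_inv_sylvester (n + 1)
  linarith

theorem inv_sylvester_le_of_prod_le {γ : ℕ → ℝ} (n : ℕ) (hγ : AntitoneOn γ (Set.Iio n))
    (h : ∀ j ≤ n, ∏ i ∈ Finset.range j, γ i ≤ 1 - ∑ i ∈ Finset.range j, γ i) :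
    ((sylvester (n + 1) : ℝ) - 1)⁻¹ ≤ 1 - ∑ i ∈ Finset.range n, γ i := by
  rw [sylvester_succ_sub_one, ← Finset.prod_inv_distrib, ← sum_inv_sylvester]
  linarith [sum_le_sum_inv_sylvester n hγ h]

/-! ### Geometry of numbers: linear forms -/

/-- Minkowski's theorem on linear forms. -/
theorem exists_ne_zero_forall_abs_mulVec_lt {ι : Type*} [Fintype ι] [DecidableEq ι]
    (A : Matrix ι ι ℝ) (hA : A.det ≠ 0) (c : ι → ℝ) (hc : ∀ i, 0 ≤ c i)
    (h : |A.det| < ∏ i, c i) :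
    ∃ q : ι → ℤ, q ≠ 0 ∧ ∀ i, |A.mulVec (fun j => (q j : ℝ)) i| < c i := by
  classical
  set b := Pi.basisFun ℝ ι
  have fund := ZSpan.isAddFundamentalDomain' b MeasureTheory.volume
  set s : Set (ι → ℝ) := Matrix.toLin' A ⁻¹' Set.pi Set.univ fun i => Set.Ioo (-c i) (c i)
  have hdet : LinearMap.det (Matrix.toLin' A) ≠ 0 := by rwa [LinearMap.det_toLin']
  have hsymm : ∀ x ∈ s, -x ∈ s := by
    intro x hx
    simp only [s, Set.mem_preimage, Set.mem_univ_pi, map_neg, Pi.neg_apply, Set.mem_Ioo] at hx ⊢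
    exact fun i => ⟨by linarith [(hx i).2], by linarith [(hx i).1]⟩
  have hconv : Convex ℝ s :=
    (convex_pi fun i _ => convex_Ioo (-c i) (c i)).linear_preimage (Matrix.toLin' A)
  have hvol : MeasureTheory.volume (ZSpan.fundamentalDomain b) * 2 ^ Module.finrank ℝ (ι → ℝ) <
      MeasureTheory.volume s := by
    rw [MeasureTheory.Measure.addHaar_preimage_linearMap _ hdet, Real.volume_pi_Ioo,
      LinearMap.det_toLin', ← ENNReal.ofReal_prod_of_nonneg (fun i _ => by linarith [hc i]),
      ← ENNReal.ofReal_mul (abs_nonneg _), Module.finrank_fintype_fun_eq_card,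
      ZSpan.volume_fundamentalDomain]
    have h1 : Matrix.of (b : ι → ι → ℝ) = 1 := by
      ext i j
      simp [b, Matrix.one_apply, Pi.single_apply, eq_comm]
    have h2 : ∏ i, (c i - -c i) = 2 ^ Fintype.card ι * ∏ i, c i := by
      simp [← two_mul, Finset.prod_mul_distrib]
    rw [h1, h2, Matrix.det_one, abs_one, ENNReal.ofReal_one, one_mul,
      show (2 : ℝ≥0∞) ^ Fintype.card ι = ENNReal.ofReal (2 ^ Fintype.card ι) by
        rw [ENNReal.ofReal_pow (by norm_num)]; simp]
    refine (ENNReal.ofReal_lt_ofReal_iff_of_nonneg (by positivity)).2 ?_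
    rw [abs_inv, mul_left_comm]
    refine lt_mul_of_one_lt_right (by positivity) ?_
    rwa [inv_mul_eq_div, one_lt_div (abs_pos.2 hA)]
  have : Countable (Submodule.span ℤ (Set.range b)).toAddSubgroup :=
    inferInstanceAs (Countable (Submodule.span ℤ (Set.range b)))
  obtain ⟨⟨x, hx⟩, hx0, hxs⟩ :=
    MeasureTheory.exists_ne_zero_mem_lattice_of_measure_mul_two_pow_lt_measure fund hsymm hconv
      hvol
  have hx' : ∀ i, ∃ z : ℤ, (z : ℝ) = x i := by
    simpa [b] using (b.mem_span_iff_repr_mem ℤ x).1 hx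
  choose q hq using hx'
  obtain rfl : (fun i => (q i : ℝ)) = x := funext hq
  refine ⟨q, ?_, fun i => abs_lt.2 ?_⟩
  · rintro rfl
    exact hx0 (Subtype.ext (by ext; simp))
  · simpa [s] using (Set.mem_univ_pi.1 hxs i)

/-! ### Maximizing the least coefficient -/

section ProductSum

variable {ι : Type*} [Fintype ι] {L : AddSubgroup (ι → ℝ)}

/-- The product-sum inequality for a point whose least coordinate is as large as possible. -/
theorem prod_sub_le_one_sub_sum [DecidableEq ι] (hL : ∀ i, Pi.single i 1 ∈ L) {β : ι → ℝ}
    (hβL : β ∈ L) (hβ1 : ∑ i, β i = 1) {ε : ℝ} (hε : 0 < ε) (hβ : ∀ i, ε ≤ β i)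
    (hmax : ∀ β' ∈ L, ∑ i, β' i = 1 → ∃ i, β' i ≤ ε) {J : Finset ι} (hJ : J ≠ Finset.univ) :
    ∏ i ∈ J, (β i - ε) ≤ 1 - ∑ i ∈ J, β i := by
  by_contra! hlt
  have hpos : ∀ i, 0 < β i := fun i => hε.trans_le (hβ i)
  have hσ : 0 < 1 - ∑ i ∈ J, β i := by
    rw [← hβ1, ← Finset.sum_compl_add_sum J, add_sub_cancel_right]
    refine Finset.sum_pos (fun i _ => hpos i) ?_
    rwa [Finset.nonempty_iff_ne_empty, Ne, Finset.compl_eq_empty_iff]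
  -- A = I − β 1ᵀ, so that A q = q − (∑ q) β and the rank-one determinant formula applies.
  set A : Matrix J J ℝ := 1 + Matrix.replicateCol Unit (fun i : J => -β i) *
    Matrix.replicateRow Unit (fun _ : J => (1 : ℝ))
  have hdet : A.det = 1 - ∑ i ∈ J, β i := by
    rw [Matrix.det_one_add_replicateCol_mul_replicateRow]
    simp [dotProduct, ← Finset.sum_coe_sort J, sub_eq_add_neg]
  have hmul : ∀ (q : J → ℝ) (i : J), A.mulVec q i = q i - β i * ∑ j, q j := by
    intro q i
    rw [Matrix.add_mulVec, Matrix.one_mulVec, Pi.add_apply]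
    simp [Matrix.mulVec, dotProduct, Matrix.mul_apply, Finset.mul_sum, sub_eq_add_neg]
  obtain ⟨q, hq0, hq⟩ := exists_ne_zero_forall_abs_mulVec_lt A (hdet ▸ hσ.ne')
    (fun i : J => β i - ε) (fun i => sub_nonneg.2 (hβ i)) (by
      rw [hdet, abs_of_pos hσ, Finset.prod_coe_sort J fun i => β i - ε]; exact hlt)
  simp only [hmul] at hq
  have hsum0 : ∑ j, q j ≠ 0 := by
    intro h0
    have h0' : ∑ j, (q j : ℝ) = 0 := by exact_mod_cast h0
    refine hq0 (funext fun i => ?_)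
    have h1 := hq i
    rw [h0', mul_zero, sub_zero] at h1
    have h2 : β i ≤ 1 := hβ1 ▸ Finset.single_le_sum (fun j _ => (hpos j).le) (Finset.mem_univ _)
    have h3 : |(q i : ℝ)| < 1 := by linarith
    exact Int.abs_lt_one_iff.1 (by exact_mod_cast h3)
  wlog hm : 0 < ∑ j, q j generalizing q
  · refine this (-q) (neg_ne_zero.2 hq0) (fun i => ?_) (by simpa using hsum0) ?_
    · rw [← abs_neg]
      refine lt_of_eq_of_lt (congrArg _ ?_) (hq i)
      simp; ring
    · simp only [Pi.neg_apply, Finset.sum_neg_distrib]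
      omega
  set m := ∑ j, q j with hmdef
  have hm' : (0 : ℝ) < m := by exact_mod_cast hm
  have hqm : ∑ j, (q j : ℝ) = m := by rw [hmdef]; push_cast; rfl
  rw [hqm] at hq
  -- The sum is (m + 1) − m = 1; on J the coordinate is β_i − (q_i − mβ_i) > ε, off J it is (m +
  -- 1)β_i > ε.
  set β' : ι → ℝ := (m + 1) • β - ∑ j : J, q j • Pi.single (j : ι) (1 : ℝ)
  have hβ'L : β' ∈ L :=
    L.sub_mem (L.zsmul_mem hβL _) (L.sum_mem fun j _ => L.zsmul_mem (hL _) _)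
  have hval : ∀ i, β' i = (m + 1) * β i - ∑ j : J, (q j : ℝ) * (Pi.single (j : ι) (1 : ℝ) : ι → ℝ) i := by
    intro i; simp [β', Finset.sum_apply]
  have hin : ∀ i : J, β' i = (m + 1) * β i - q i := by
    intro i
    rw [hval, Finset.sum_eq_single i]
    · simp
    · intro j _ hj
      simp [hj.symm]
    · simp
  have hout : ∀ i ∉ J, β' i = (m + 1) * β i := by
    intro i hi
    rw [hval, Finset.sum_eq_zero, sub_zero]
    intro j _
    have : i ≠ j := fun h => hi (h ▸ j.2)
    simp [this]
  have hsum : ∑ i, β' i = 1 := by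
    simp_rw [hval]
    rw [Finset.sum_sub_distrib, ← Finset.mul_sum, hβ1, Finset.sum_comm]
    simp_rw [← Finset.mul_sum, Finset.sum_pi_single', Finset.mem_univ, if_true, mul_one, hqm]
    ring
  obtain ⟨i, hi⟩ := hmax β' hβ'L hsum
  by_cases hiJ : i ∈ J
  · have h1 := hin ⟨i, hiJ⟩
    have h2 := (abs_lt.1 (hq ⟨i, hiJ⟩)).2
    simp only at h1 h2
    linarith
  · have h1 := hout i hiJ
    have := mul_pos hm' (hpos i)
    linarith [hβ i]

/-- A closed group of vectors containing `ℤ^ι` and a positive vector of coordinate sum `1`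
contains such a vector all of whose coordinates are bounded below. -/
theorem exists_mem_forall_inv_le [Nonempty ι] [DecidableEq ι] (hcl : IsClosed (L : Set (ι → ℝ)))
    (hL : ∀ i, Pi.single i 1 ∈ L) {β₀ : ι → ℝ} (h₀L : β₀ ∈ L) (h₀1 : ∑ i, β₀ i = 1)
    (h₀ : ∀ i, 0 < β₀ i) :
    ∃ β ∈ L, ∑ i, β i = 1 ∧ ∀ i,
      ((Fintype.card ι : ℝ) * ((sylvester (Fintype.card ι) : ℝ) - 1))⁻¹ ≤ β i := by
  set f : (ι → ℝ) → ℝ := fun β => Finset.univ.inf' Finset.univ_nonempty fun i => β i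
  have hf : Continuous f := Continuous.finset_inf'_apply _ fun i _ => continuous_apply i
  obtain ⟨β, ⟨hβL, hβΔ⟩, hβmax⟩ := ((isCompact_stdSimplex ℝ ι).inter_left hcl).exists_isMaxOn
    ⟨β₀, h₀L, fun i => (h₀ i).le, h₀1⟩ hf.continuousOn
  have hβ1 : ∑ i, β i = 1 := hβΔ.2
  set ε := f β
  have hε : 0 < ε := by
    refine lt_of_lt_of_le ?_ (hβmax ⟨h₀L, fun i => (h₀ i).le, h₀1⟩)
    exact (Finset.lt_inf'_iff _).2 fun i _ => h₀ i
  have hβ : ∀ i, ε ≤ β i := fun i => Finset.inf'_le _ (Finset.mem_univ i)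
  have hmax : ∀ β' ∈ L, ∑ i, β' i = 1 → ∃ i, β' i ≤ ε := by
    intro β' hβ' h1
    by_contra! hlt
    have h2 : ε < f β' := (Finset.lt_inf'_iff _).2 fun i _ => hlt i
    exact h2.not_ge (hβmax ⟨hβ', fun i => (hε.trans (hlt i)).le, h1⟩)
  obtain ⟨n, hn⟩ : ∃ n, Fintype.card ι = n + 1 := ⟨Fintype.card ι - 1, by
    have := Fintype.card_pos (α := ι); omega⟩
  obtain ⟨e, he⟩ : ∃ e : Fin (n + 1) ≃ ι, Antitone (β ∘ e) := by
    let e₀ := (Fintype.equivFinOfCardEq hn).symm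
    refine ⟨(Tuple.sort (OrderDual.toDual ∘ β ∘ e₀)).trans e₀, fun i j hij => ?_⟩
    exact Tuple.monotone_sort (OrderDual.toDual ∘ β ∘ e₀) hij
  have hlast : β (e (Fin.last n)) = ε := by
    obtain ⟨i, _, hi⟩ := Finset.exists_mem_eq_inf' Finset.univ_nonempty fun i => β i
    refine le_antisymm ?_ (hβ _)
    change _ ≤ Finset.univ.inf' Finset.univ_nonempty fun i => β i
    rw [hi]
    simpa using he (Fin.le_last (e.symm i))
  set γ : ℕ → ℝ := fun i => if h : i < n + 1 then β (e ⟨i, h⟩) - ε else 0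
  have hγ : AntitoneOn γ (Set.Iio n) := by
    intro i hi j hj hij
    simp only [Set.mem_Iio] at hi hj
    simp only [γ, dif_pos (show i < n + 1 by omega), dif_pos (show j < n + 1 by omega)]
    have := he (show (⟨i, by omega⟩ : Fin (n + 1)) ≤ ⟨j, by omega⟩ from hij)
    simp only [Function.comp_apply] at this
    linarith
  -- Quantifying over commutative monoids lets one reindexing serve products and, through
  -- `Multiplicative ℝ`, sums.
  have hJ : ∀ j ≤ n, ∃ J : Finset ι, J ≠ Finset.univ ∧ ∀ M : Type, ∀ [CommMonoid M], ∀ g : ℝ → M,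
      ∏ i ∈ Finset.range j, g (γ i) = ∏ i ∈ J, g (β i - ε) := by
    intro j hj
    refine ⟨Finset.univ.map ((Fin.castLEEmb (show j ≤ n + 1 by omega)).trans e.toEmbedding),
      fun h => ?_, fun M _ g => ?_⟩
    · have := congrArg Finset.card h
      simp [hn] at this
      omega
    · rw [Finset.prod_map, ← Fin.prod_univ_eq_prod_range (fun i => g (γ i))]
      refine Finset.prod_congr rfl fun i _ => ?_
      simp only [γ, dif_pos (show (i : ℕ) < n + 1 by omega)]
      rfl
  have hps : ∀ j ≤ n, ∏ i ∈ Finset.range j, γ i ≤ 1 - ∑ i ∈ Finset.range j, γ i := by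
    intro j hj
    obtain ⟨J, hJu, hJ⟩ := hJ j hj
    have hp := hJ ℝ id
    have hs := congrArg Multiplicative.toAdd (hJ (Multiplicative ℝ) Multiplicative.ofAdd)
    simp only [toAdd_prod, toAdd_ofAdd, id] at hp hs
    rw [hp, hs]
    refine (prod_sub_le_one_sub_sum hL hβL hβ1 hε hβ hmax hJu).trans ?_
    gcongr
    linarith
  have hfin := inv_sylvester_le_of_prod_le n hγ hps
  -- The last term γ_n vanishes, so the first n terms already carry the total 1 − (n + 1)ε.
  have hsum : 1 - ∑ i ∈ Finset.range n, γ i = (n + 1) * ε := by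
    have h1 : ∑ i ∈ Finset.range (n + 1), γ i = 1 - (n + 1) * ε := by
      have h2 : ∀ i : Fin (n + 1), γ i = β (e i) - ε := fun i => dif_pos i.2
      rw [← Fin.sum_univ_eq_sum_range, Finset.sum_congr rfl fun i _ => h2 i,
        Finset.sum_sub_distrib, e.sum_comp, hβ1]
      simp
    have h2 : γ n = 0 := by
      simp only [γ, dif_pos n.lt_succ_self, sub_eq_zero]
      exact hlast
    rw [Finset.sum_range_succ, h2] at h1
    linarith
  refine ⟨β, hβL, hβ1, fun i => le_trans ?_ (hβ i)⟩
  rw [hn, mul_inv, inv_mul_le_iff₀ (by positivity)]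
  push_cast
  linarith

end ProductSum

/-! ### Blichfeldt's principle and volume -/

theorem mem_latticePoints_iff {d : ℕ} {x : Fin d → ℝ} :
    x ∈ latticePoints d ↔ x ∈ Submodule.span ℤ (Set.range (Pi.basisFun ℝ (Fin d))) := by
  rw [(Pi.basisFun ℝ (Fin d)).mem_span_iff_repr_mem ℤ x]
  constructor
  · rintro ⟨z, rfl⟩ i
    exact ⟨z i, by simp⟩
  · intro h
    choose z hz using h
    exact ⟨z, funext fun i => by simpa using hz i⟩

theorem add_mem_latticePoints {d : ℕ} {x y : Fin d → ℝ} (hx : x ∈ latticePoints d)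
    (hy : y ∈ latticePoints d) : x + y ∈ latticePoints d := by
  rw [mem_latticePoints_iff] at *
  exact add_mem hx hy

theorem sub_mem_latticePoints {d : ℕ} {x y : Fin d → ℝ} (hx : x ∈ latticePoints d)
    (hy : y ∈ latticePoints d) : x - y ∈ latticePoints d := by
  rw [mem_latticePoints_iff] at *
  exact sub_mem hx hy

theorem isClosed_latticePoints (d : ℕ) : IsClosed (latticePoints d) := by
  have h : latticePoints d = Set.pi Set.univ fun _ => Set.range ((↑) : ℤ → ℝ) := by
    ext x
    simp only [latticePoints, Set.mem_range, Set.mem_univ_pi]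
    constructor
    · rintro ⟨z, rfl⟩ i
      exact ⟨z i, rfl⟩
    · intro h
      choose z hz using h
      exact ⟨z, funext hz⟩
  rw [h]
  exact isClosed_set_pi fun _ _ => Int.isClosedEmbedding_coe_real.isClosed_range

/-- Blichfeldt's principle with multiplicity: a set of volume more than `k` has a translate that
contains more than `k` lattice points. -/
theorem exists_lt_encard_translate {d k : ℕ} {E : Set (Fin d → ℝ)} (hE : MeasurableSet E)
    (h : (k : ℝ≥0∞) < MeasureTheory.volume E) :
    ∃ x, (k : ℕ∞) < {z | z ∈ latticePoints d ∧ x + z ∈ E}.encard := by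
  set b := Pi.basisFun ℝ (Fin d)
  set Λ := (Submodule.span ℤ (Set.range b)).toAddSubgroup
  have : Countable Λ := inferInstanceAs (Countable (Submodule.span ℤ (Set.range b)))
  have fund := ZSpan.isAddFundamentalDomain' b MeasureTheory.volume
  by_contra! hle
  refine h.not_ge ?_
  have hF : MeasureTheory.volume (ZSpan.fundamentalDomain b) = 1 := by
    rw [ZSpan.fundamentalDomain_pi_basisFun, Real.volume_pi_Ico]
    simp
  calc MeasureTheory.volume E = ∫⁻ x, E.indicator 1 x := by
        rw [MeasureTheory.lintegral_indicator_one hE]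
    _ = ∑' g : Λ, ∫⁻ x in ZSpan.fundamentalDomain b, E.indicator 1 (-g +ᵥ x) :=
        fund.lintegral_eq_tsum' _
    _ = ∑' g : Λ, ∫⁻ x in ZSpan.fundamentalDomain b, E.indicator 1 (g +ᵥ x) :=
        (Equiv.neg Λ).tsum_eq fun g => ∫⁻ x in ZSpan.fundamentalDomain b, E.indicator 1 (g +ᵥ x)
    _ = ∫⁻ x in ZSpan.fundamentalDomain b, ∑' g : Λ, E.indicator 1 (g +ᵥ x) := by
        rw [MeasureTheory.lintegral_tsum]
        intro g
        exact ((measurable_one.indicator hE).comp (measurable_const_vadd g)).aemeasurable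
    _ ≤ ∫⁻ _ in ZSpan.fundamentalDomain b, (k : ℝ≥0∞) := by
        refine MeasureTheory.lintegral_mono fun x => ?_
        have h1 : ∑' g : Λ, E.indicator (1 : (Fin d → ℝ) → ℝ≥0∞) (g +ᵥ x) =
            ({g : Λ | x + g ∈ E}.encard : ℝ≥0∞) := by
          rw [← ENNReal.tsum_set_one, tsum_subtype {g : Λ | x + g ∈ E} fun _ => 1]
          refine tsum_congr fun g => ?_
          have h2 : g +ᵥ x ∈ E ↔ g ∈ {g : Λ | x + g ∈ E} :=
            iff_of_eq (congrArg (· ∈ E) (add_comm (g : Fin d → ℝ) x))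
          by_cases h3 : g ∈ {g : Λ | x + g ∈ E}
          · rw [Set.indicator_of_mem h3, Set.indicator_of_mem (h2.2 h3), Pi.one_apply]
          · rw [Set.indicator_of_notMem h3, Set.indicator_of_notMem (mt h2.1 h3)]
        have h2 : {g : Λ | x + g ∈ E}.encard ≤ (k : ℕ∞) := by
          rw [← Subtype.val_injective.encard_image]
          refine (Set.encard_le_encard ?_).trans (hle x)
          rintro _ ⟨g, hg, rfl⟩
          exact ⟨mem_latticePoints_iff.2 g.2, hg⟩
        rw [h1]
        exact ENat.toENNReal_le.2 h2
    _ = k := by simp [hF]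

open scoped Pointwise in
/-- A convex set with `k` interior lattice points has volume at most `N ^ d * k` if its asymmetry
about some lattice point is at most `N - 1`. -/
theorem volume_le_of_asymmetry {d k : ℕ} {P : Set (Fin d → ℝ)} (hP : Convex ℝ P)
    (hk : (interior P ∩ latticePoints d).encard = (k : ℕ∞)) {w : Fin d → ℝ}
    (hw : w ∈ latticePoints d) {N : ℝ} (hN : 1 < N)
    (h : ∀ p ∈ P, (N - 1)⁻¹ • (N • w - p) ∈ P) :
    MeasureTheory.volume P ≤ ENNReal.ofReal (N ^ d * k) := by
  have hN0 : 0 < N := one_pos.trans hN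
  by_contra! hlt
  set E := N⁻¹ • interior P
  have hE : (k : ℝ≥0∞) < MeasureTheory.volume E := by
    rw [MeasureTheory.Measure.addHaar_smul_of_nonneg _ (inv_pos.2 hN0).le,
      measure_interior_of_null_frontier (hP.addHaar_frontier _), Module.finrank_fin_fun]
    have h1 : (k : ℝ≥0∞) = ENNReal.ofReal (N⁻¹ ^ d) * ENNReal.ofReal (N ^ d * k) := by
      rw [← ENNReal.ofReal_mul (by positivity), ← mul_assoc, ← mul_pow, inv_mul_cancel₀ hN0.ne']
      simp
    rw [h1]
    exact ENNReal.mul_lt_mul_right (by simp [hN0]) ENNReal.ofReal_ne_top hlt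
  obtain ⟨x, hx⟩ := exists_lt_encard_translate
    (isOpen_interior.smul₀ (inv_ne_zero hN0.ne')).measurableSet hE
  obtain ⟨z₀, hz₀, a₀, ha₀, hxz₀⟩ := Set.nonempty_of_encard_ne_zero (pos_of_gt hx).ne'
  refine hx.not_ge (hk ▸ ?_)
  refine Set.encard_le_encard_of_injOn (f := fun z => z - z₀ + w) ?_ ?_
  · rintro z ⟨hz, a, ha, hxz⟩
    refine ⟨?_, add_mem_latticePoints (sub_mem_latticePoints hz hz₀) hw⟩
    -- z − z₀ + w is N⁻¹ a plus (1 − N⁻¹) times the reflected point (N w − a₀)/(N − 1) of P.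
    have hcomb := hP.combo_interior_self_mem_interior ha (h a₀ (interior_subset ha₀))
      (inv_pos.2 hN0) (sub_nonneg.2 (inv_le_one_of_one_le₀ hN.le)) (by ring)
    convert hcomb using 1
    have hzz : z - z₀ = N⁻¹ • a - N⁻¹ • a₀ := by
      simp only at hxz hxz₀
      rw [hxz, hxz₀]
      abel
    have hc : (1 - N⁻¹) * (N - 1)⁻¹ = N⁻¹ := by
      have := sub_ne_zero.2 hN.ne'
      field_simp
    change z - z₀ + w = _
    rw [hzz, smul_smul, hc, smul_sub, smul_smul, inv_mul_cancel₀ hN0.ne', one_smul]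
    abel
  · intro z _ z' _ hzz
    simpa using hzz

/-! ### Convex combinations and simplices -/

/-- A lattice point that is a positive convex combination of lattice points can be replaced by one
with coefficients bounded below. -/
theorem exists_latticePoint_combination {d : ℕ} {ι : Type*} [Fintype ι] [Nonempty ι]
    {v : ι → Fin d → ℝ} (hv : ∀ i, v i ∈ latticePoints d) {β₀ : ι → ℝ} (h₀ : ∀ i, 0 < β₀ i)
    (h₀1 : ∑ i, β₀ i = 1) (h₀v : ∑ i, β₀ i • v i ∈ latticePoints d) :
    ∃ β : ι → ℝ, ∑ i, β i = 1 ∧ ∑ i, β i • v i ∈ latticePoints d ∧ ∀ i,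
      ((Fintype.card ι : ℝ) * ((sylvester (Fintype.card ι) : ℝ) - 1))⁻¹ ≤ β i := by
  classical
  set φ : (ι → ℝ) →ₗ[ℝ] Fin d → ℝ := Fintype.linearCombination ℝ v
  have hφ : ∀ β, φ β = ∑ i, β i • v i := Fintype.linearCombination_apply ℝ v
  -- L need not be discrete, since the points may be affinely dependent or repeated; closedness is
  -- enough.
  set L : AddSubgroup (ι → ℝ) :=
    (Submodule.span ℤ (Set.range (Pi.basisFun ℝ (Fin d)))).toAddSubgroup.comap φ.toAddMonoidHom
  have hmem : ∀ β, β ∈ L ↔ ∑ i, β i • v i ∈ latticePoints d := fun β => by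
    rw [← hφ, mem_latticePoints_iff]; rfl
  have hcl : IsClosed (L : Set (ι → ℝ)) := by
    have h : (L : Set (ι → ℝ)) = φ ⁻¹' latticePoints d := by
      ext β
      rw [Set.mem_preimage, hφ]
      exact hmem β
    rw [h]
    exact (isClosed_latticePoints d).preimage φ.continuous_of_finiteDimensional
  have hL : ∀ i, Pi.single i 1 ∈ L := fun i => by
    rw [hmem, ← hφ, Fintype.linearCombination_apply_single, one_smul]
    exact hv i
  obtain ⟨β, hβL, hβ⟩ := exists_mem_forall_inv_le hcl hL ((hmem β₀).2 h₀v) h₀1 h₀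
  exact ⟨β, hβ.1, (hmem β).1 hβL, hβ.2⟩

/-- A vanishing barycentric coordinate of an interior point of a segment in the simplex vanishes at
both ends. This makes the points of the basis lattice points. -/
theorem AffineBasis.mem_extremePoints_convexHull {ι E : Type*} [Finite ι] [NormedAddCommGroup E]
    [NormedSpace ℝ E] (b : AffineBasis ι ℝ E) (i : ι) :
    b i ∈ (convexHull ℝ (Set.range b)).extremePoints ℝ := by
  have := Fintype.ofFinite ι
  refine mem_extremePoints_iff_left.2 ⟨subset_convexHull ℝ _ ⟨i, rfl⟩, ?_⟩
  rintro y hy z hz ⟨s, t, hs, ht, hst, hyz⟩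
  rw [b.convexHull_eq_nonneg_coord] at hy hz
  refine b.ext_elem fun j => ?_
  have hne : ∀ j ≠ i, b.coord j y = 0 := by
    intro j hj
    have h := congrArg (b.coord j) hyz
    rw [Convex.combo_affine_apply hst, b.coord_apply_ne hj, smul_eq_mul, smul_eq_mul] at h
    nlinarith [hy j, mul_nonneg hs.le (hy j), mul_nonneg ht.le (hz j), mul_pos hs ht]
  by_cases hj : j = i
  · subst hj
    rw [b.coord_apply_eq, ← b.sum_coord_apply_eq_one y]
    exact (Fintype.sum_eq_single j hne).symm
  · rw [hne j hj, b.coord_apply_ne hj]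

/-- A finite spanning set contains an affine basis with respect to which every point of its convex
hull has barycentric coordinates at most `1`, namely a simplex of maximal volume. -/
theorem exists_affineBasis_coord_le_one {d : ℕ} {V : Set (Fin d → ℝ)} (hV : V.Finite)
    (hspan : affineSpan ℝ V = ⊤) :
    ∃ b : AffineBasis (Fin (d + 1)) ℝ (Fin d → ℝ), (∀ i, b i ∈ V) ∧
      ∀ p ∈ convexHull ℝ V, ∀ i, b.coord i p ≤ 1 := by
  obtain ⟨b₀, hb₀⟩ : ∃ b : AffineBasis (Fin (d + 1)) ℝ (Fin d → ℝ), ∀ i, b i ∈ V := by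
    obtain ⟨s, hs, b, hb⟩ := AffineBasis.exists_affine_subbasis hspan
    have := (hV.subset hs).fintype
    have hcard : Fintype.card s = d + 1 := by
      simpa using b.ind.affineSpan_eq_top_iff_card_eq_finrank_add_one.1 b.tot
    exact ⟨b.reindex (Fintype.equivFinOfCardEq hcard), fun i => by
      rw [b.reindex_apply, hb]; exact hs (Subtype.coe_prop _)⟩
  obtain ⟨f, hf, hmax⟩ := (Set.Finite.pi' fun _ : Fin (d + 1) => hV).exists_maximalFor
    (fun f => |(b₀.toMatrix f).det|) _ ⟨b₀, hb₀⟩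
  replace hmax : ∀ g : Fin (d + 1) → Fin d → ℝ, (∀ i, g i ∈ V) →
      |(b₀.toMatrix g).det| ≤ |(b₀.toMatrix f).det| := fun g hg =>
    (le_total _ _).elim id fun h => hmax hg h
  have hdet : 0 < |(b₀.toMatrix f).det| := by
    refine lt_of_lt_of_le ?_ (hmax b₀ hb₀)
    simp
  obtain ⟨h1, h2⟩ := (b₀.isUnit_toMatrix_iff f).1
    ((Matrix.isUnit_iff_isUnit_det _).2 (isUnit_iff_ne_zero.2 (abs_pos.1 hdet)))
  set b : AffineBasis (Fin (d + 1)) ℝ (Fin d → ℝ) := ⟨f, h1, h2⟩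
  refine ⟨b, hf, fun p hp i => ?_⟩
  have hsub : V ⊆ {p | b.coord i p ≤ 1} := by
    intro p hp
    -- By Cramer's rule, replacing vertex i by p multiplies the determinant by the i-th barycentric
    -- coordinate of p.
    have h := congrFun (b₀.det_smul_coords_eq_cramer_coords b p) i
    have hupd : (b₀.toMatrix b).updateRow i (b₀.coords p) =
        b₀.toMatrix (Function.update f i p) := by
      ext j l
      by_cases hj : j = i
      · subst hj; simp
      · simp [hj]; rfl
    rw [Matrix.cramer_transpose_apply, hupd, Pi.smul_apply, smul_eq_mul, b.coords_apply] at h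
    have hle := hmax (Function.update f i p) fun j => by
      by_cases hj : j = i
      · subst hj; simpa using hp
      · simpa [hj] using hf j
    rw [← h, abs_mul] at hle
    exact (le_abs_self _).trans (le_of_mul_le_mul_left (hle.trans_eq (mul_one _).symm) hdet)
  exact convexHull_min hsub ((convex_Iic (1 : ℝ)).affine_preimage (b.coord i)) hp

/-- Carathéodory's theorem relative to a point `s`: a convex combination of `s` and of points of
`W` can be reduced to `s` and at most `finrank` points of `W` without losing weight at `s`. -/
theorem exists_card_le_finrank_of_combination {E : Type*} [AddCommGroup E] [Module ℝ E]
    [FiniteDimensional ℝ E] (s : E) {x : E} (W : Finset E) {r : ℝ} {a : E → ℝ} (hr : 0 < r)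
    (ha : ∀ w ∈ W, 0 ≤ a w) (hsum : r + ∑ w ∈ W, a w = 1) (hx : r • s + ∑ w ∈ W, a w • w = x) :
    ∃ W' ⊆ W, W'.card ≤ Module.finrank ℝ E ∧ ∃ (r' : ℝ) (a' : E → ℝ), 0 < r' ∧
      (∀ w ∈ W', 0 < a' w) ∧ r' + ∑ w ∈ W', a' w = 1 ∧ r' • s + ∑ w ∈ W', a' w • w = x := by
  classical
  induction hn : W.card using Nat.strong_induction_on generalizing W r a with
  | _ n ih =>
  subst hn
  by_cases hpos : ∀ w ∈ W, a w ≠ 0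
  swap
  · push Not at hpos
    obtain ⟨w, hw, haw⟩ := hpos
    obtain ⟨W', hW', h⟩ := ih _ (Finset.card_erase_lt_of_mem hw) (W.erase w) hr
      (fun u hu => ha u (Finset.mem_of_mem_erase hu))
      (by rw [Finset.sum_erase _ haw, hsum])
      (by rw [Finset.sum_erase _ (by rw [haw, zero_smul]), hx]) rfl
    exact ⟨W', hW'.trans (Finset.erase_subset _ _), h⟩
  by_cases hcard : W.card ≤ Module.finrank ℝ E
  · exact ⟨W, subset_rfl, hcard, r, a, hr,
      fun w hw => (ha w hw).lt_of_ne' (hpos w hw), hsum, hx⟩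
  by_cases hs : s ∈ W
  · obtain ⟨W', hW', h⟩ := ih _ (Finset.card_erase_lt_of_mem hs) (W.erase s) (r := r + a s)
      (by linarith [ha s hs]) (fun u hu => ha u (Finset.mem_of_mem_erase hu))
      (by rw [add_assoc, Finset.add_sum_erase _ _ hs, hsum])
      (by rw [add_smul, add_assoc, Finset.add_sum_erase _ (fun w => a w • w) hs, hx]) rfl
    exact ⟨W', hW'.trans (Finset.erase_subset _ _), h⟩
  obtain ⟨f, hf0, hf1, u, hu, hfu⟩ :=
    Module.exists_nontrivial_relation_sum_zero_of_finrank_succ_lt_card (R := ℝ)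
      (t := insert s W) (by rw [Finset.card_insert_of_notMem hs]; omega)
  -- With this sign, moving along the relation f never lowers the weight at s.
  wlog hfs : 0 ≤ f s generalizing f
  · refine this (-f) ?_ ?_ (by simpa using hfu) (by simp; linarith)
    · simp [hf0]
    · simp [hf1]
  rw [Finset.sum_insert hs] at hf0 hf1
  obtain ⟨w₁, hw₁, hfw₁⟩ : ∃ w ∈ W, f w < 0 := by
    by_contra! hnn
    have h1 : ∑ w ∈ W, f w = 0 := by linarith [Finset.sum_nonneg hnn]
    have h2 : f s = 0 := by linarith
    rcases Finset.mem_insert.1 hu with rfl | hu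
    · exact hfu h2
    · exact hfu ((Finset.sum_eq_zero_iff_of_nonneg hnn).1 h1 u hu)
  -- w₀ is a point whose coefficient reaches zero first.
  obtain ⟨w₀, hw₀, hmin⟩ := (W.filter fun w => f w < 0).exists_min_image (fun w => a w / -f w)
    ⟨w₁, Finset.mem_filter.2 ⟨hw₁, hfw₁⟩⟩
  rw [Finset.mem_filter] at hw₀
  set τ := a w₀ / -f w₀
  have hτ : 0 ≤ τ := div_nonneg (ha _ hw₀.1) (by linarith [hw₀.2])
  have hzero : a w₀ + τ * f w₀ = 0 := by
    have := hw₀.2.ne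
    simp only [τ]
    field_simp
    ring
  obtain ⟨W', hW', h⟩ := ih _ (Finset.card_erase_lt_of_mem hw₀.1) (W.erase w₀)
    (r := r + τ * f s) (a := fun w => a w + τ * f w) (by positivity) (fun w hw => by
      have hw := Finset.mem_of_mem_erase hw
      by_cases hfw : f w < 0
      · have := hmin w (Finset.mem_filter.2 ⟨hw, hfw⟩)
        rw [le_div_iff₀ (by linarith)] at this
        linarith
      · have := mul_nonneg hτ (not_lt.1 hfw)
        linarith [ha w hw])
    (by
      rw [Finset.sum_erase (f := fun w => a w + τ * f w) _ hzero, Finset.sum_add_distrib, ← Finset.mul_sum]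
      linear_combination hsum + τ * hf1)
    (by
      rw [Finset.sum_erase (f := fun w => (a w + τ * f w) • w) _ (by rw [hzero, zero_smul])]
      simp_rw [add_smul, mul_smul]
      rw [Finset.sum_add_distrib, ← Finset.smul_sum, add_add_add_comm, ← smul_add, hf0, smul_zero,
        add_zero, hx]) rfl
  exact ⟨W', hW'.trans (Finset.erase_subset _ _), h⟩

/-! ### Asymmetry of lattice polytopes -/

theorem IsLatticePolytope.finite_extremePoints {d : ℕ} {P : Set (Fin d → ℝ)}
    (hP : IsLatticePolytope P) : (P.extremePoints ℝ).Finite := by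
  obtain ⟨⟨F, hF, rfl⟩, -⟩ := hP
  exact hF.subset extremePoints_convexHull_subset

theorem IsLatticePolytope.convex {d : ℕ} {P : Set (Fin d → ℝ)} (hP : IsLatticePolytope P) :
    Convex ℝ P := by
  obtain ⟨⟨F, hF, rfl⟩, -⟩ := hP
  exact convex_convexHull ℝ F

theorem IsLatticePolytope.convexHull_extremePoints {d : ℕ} {P : Set (Fin d → ℝ)}
    (hP : IsLatticePolytope P) : convexHull ℝ (P.extremePoints ℝ) = P := by
  have hcomp : IsCompact P := by
    obtain ⟨⟨F, hF, rfl⟩, -⟩ := hP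
    exact hF.isCompact_convexHull ℝ
  rw [← (hP.finite_extremePoints.isCompact_convexHull ℝ).isClosed.closure_eq]
  exact closure_convexHull_extremePoints hcomp hP.convex

/-- A point of the interior of a convex set lies strictly between any given point of the set and
another point of the set. -/
theorem exists_combination_of_mem_interior {E : Type*} [NormedAddCommGroup E] [NormedSpace ℝ E]
    {P : Set E} {x : E} (hx : x ∈ interior P) (s : E) :
    ∃ r : ℝ, 0 < r ∧ r < 1 ∧ ∃ f ∈ P, r • s + (1 - r) • f = x := by
  -- Continue the ray from s a little beyond x.
  have hcont : ContinuousAt (fun t : ℝ => x + t • (x - s)) 0 := by fun_prop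
  have hev : ∀ᶠ t in nhds (0 : ℝ), x + t • (x - s) ∈ P :=
    hcont.eventually_mem (by simpa using mem_interior_iff_mem_nhds.1 hx)
  obtain ⟨t, ht, htP⟩ := ((hev.filter_mono nhdsWithin_le_nhds).and
    (self_mem_nhdsWithin (s := Set.Ioi (0 : ℝ)))).exists.imp fun t h => And.intro h.2 h.1
  have ht : 0 < t := ht
  refine ⟨t / (1 + t), by positivity, (div_lt_one (by positivity)).2 (by linarith), _, htP, ?_⟩
  have h1 : 1 - t / (1 + t) = 1 / (1 + t) := by field_simp; ring
  rw [h1]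
  match_scalars
  · field_simp; ring
  · field_simp

/-- A lattice polytope with an interior lattice point has bounded asymmetry about some lattice
point. -/
theorem IsLatticePolytope.exists_asymmetry_le {d : ℕ} {P : Set (Fin d → ℝ)}
    (hP : IsLatticePolytope P) (hspan : affineSpan ℝ P = ⊤) {x : Fin d → ℝ}
    (hx : x ∈ interior P) (hxL : x ∈ latticePoints d) {N : ℝ} (hN1 : 1 < N)
    (hN : (2 * (d : ℝ) + 1) * ((sylvester (2 * d + 1) : ℝ) - 1) ≤ N) :
    ∃ w ∈ latticePoints d, ∀ p ∈ P, (N - 1)⁻¹ • (N • w - p) ∈ P := by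
  classical
  have hVfin := hP.finite_extremePoints
  have hV := hP.convexHull_extremePoints
  obtain ⟨b, hbV, hb⟩ := exists_affineBasis_coord_le_one hVfin
    (by rw [← affineSpan_convexHull, hV, hspan])
  rw [hV] at hb
  -- Positive weight at the centroid spreads to all d + 1 vertices of the simplex.
  set c : Fin d → ℝ := ∑ i, ((d : ℝ) + 1)⁻¹ • b i
  obtain ⟨r, hr0, hr1, f, hfP, hrf⟩ := exists_combination_of_mem_interior hx c
  obtain ⟨a, ha0, ha1, haf⟩ := Finset.mem_convexHull'.1
    (show f ∈ convexHull ℝ (hVfin.toFinset : Set (Fin d → ℝ)) by rwa [hVfin.coe_toFinset, hV])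
  obtain ⟨W, hWV, hWcard, r, a, hr, ha, hra, hrax⟩ :=
    exists_card_le_finrank_of_combination c hVfin.toFinset (a := fun w => (1 - r) * a w) hr0
      (fun w hw => mul_nonneg (by linarith) (ha0 w hw)) (by rw [← Finset.mul_sum, ha1]; ring)
      (x := x) (by simp_rw [mul_smul]; rw [← Finset.smul_sum, haf, hrf])
  rw [Module.finrank_fin_fun] at hWcard
  -- A disjoint sum: W may meet the vertices of b, and repetitions are harmless.
  set v : Fin (d + 1) ⊕ W → Fin d → ℝ := Sum.elim b (↑)
  have hvV : ∀ i, v i ∈ P.extremePoints ℝ := by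
    rintro (i | w)
    · exact hbV i
    · exact hVfin.mem_toFinset.1 (hWV w.2)
  obtain ⟨β, hβ1, hβv, hβ⟩ := exists_latticePoint_combination (v := v)
    (β₀ := Sum.elim (fun _ => r * ((d : ℝ) + 1)⁻¹) fun w => a w)
    (fun i => hP.2 (hvV i))
    (by
      rintro (i | w)
      · simp only [Sum.elim_inl]; positivity
      · exact ha w w.2)
    (by
      refine Eq.trans ?_ hra
      rw [Fintype.sum_sum_type, ← Finset.sum_coe_sort W]
      have : (d : ℝ) + 1 ≠ 0 := by positivity
      simp
      field_simp)
    (by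
      rw [Fintype.sum_sum_type]
      simp only [Sum.elim_inl, Sum.elim_inr, v, mul_smul]
      rwa [← Finset.smul_sum, Finset.sum_coe_sort W fun w => a w • w, hrax])
  have hβN : ∀ i, 1 ≤ N * β i := by
    intro i
    obtain ⟨n, hn, hnd⟩ : ∃ n, Fintype.card (Fin (d + 1) ⊕ W) = n + 1 ∧ n ≤ 2 * d :=
      ⟨d + W.card, by simp; ring, by omega⟩
    have h1 := hβ i
    rw [hn] at h1
    have hs : (sylvester (n + 1) : ℝ) ≤ sylvester (2 * d + 1) := by
      exact_mod_cast sylvester_succ_mono hnd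
    have hpos := sylvester_succ_sub_one_pos n
    have hnd' : ((n + 1 : ℕ) : ℝ) ≤ 2 * d + 1 := by exact_mod_cast Nat.succ_le_succ hnd
    have hle : ((n + 1 : ℕ) : ℝ) * ((sylvester (n + 1) : ℝ) - 1) ≤ N :=
      le_trans (by gcongr) hN
    have h2 := (inv_anti₀ (by positivity) hle).trans h1
    rwa [inv_le_iff_one_le_mul₀' (by linarith)] at h2
  refine ⟨_, hβv, fun p hp => ?_⟩
  set γ : Fin (d + 1) ⊕ W → ℝ := Sum.elim (fun i => b.coord i p) fun _ => 0
  have hγ1 : ∑ i, γ i = 1 := by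
    simp [γ, Fintype.sum_sum_type]
  have hγv : ∑ i, γ i • v i = p := by
    simp [γ, v, Fintype.sum_sum_type, b.linear_combination_coord_eq_self]
  have hγ : ∀ i, γ i ≤ 1 := by
    rintro (i | w)
    · exact hb p hp i
    · exact zero_le_one
  have hN1' : 0 < N - 1 := sub_pos.2 hN1
  -- The weights are nonnegative because N β_i ≥ 1 ≥ γ_i.
  have hmem := hP.convex.sum_mem (t := Finset.univ) (w := fun i => (N - 1)⁻¹ * (N * β i - γ i))
    (z := v) (fun i _ => mul_nonneg (inv_pos.2 hN1').le (by linarith [hβN i, hγ i]))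
    (by
      rw [← Finset.mul_sum, Finset.sum_sub_distrib, ← Finset.mul_sum, hβ1, hγ1, mul_one,
        inv_mul_cancel₀ hN1'.ne'])
    fun i _ => extremePoints_subset (hvV i)
  simp_rw [mul_smul, sub_smul, mul_smul] at hmem
  rwa [← Finset.smul_sum, Finset.sum_sub_distrib, ← Finset.smul_sum, hγv] at hmem

/-! ### The two bounds -/

theorem nonempty_of_mem_latticePolytopes {d k : ℕ} (hk : 1 ≤ k) {P : Set (Fin d → ℝ)}
    (hP : P ∈ latticePolytopes d k) : (interior P ∩ latticePoints d).Nonempty := by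
  rw [← Set.encard_pos, hP.2.2]
  exact_mod_cast hk

theorem exists_coord_ge_of_mem_latticePolytopes {d k : ℕ} (hk : 1 ≤ k)
    (b : AffineBasis (Fin (d + 1)) ℝ (Fin d → ℝ))
    (hS : convexHull ℝ (Set.range b) ∈ latticePolytopes d k) :
    ∃ x ∈ interior (convexHull ℝ (Set.range b)) ∩ latticePoints d, ∀ i : Fin (d + 1),
      1 / (((d : ℝ) + 1) * ((sylvester (d + 1) : ℝ) - 1)) ≤ b.coord i x := by
  obtain ⟨x₀, hx₀, hx₀L⟩ := nonempty_of_mem_latticePolytopes hk hS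
  rw [b.interior_convexHull] at hx₀ ⊢
  obtain ⟨β, hβ1, hβv, hβ⟩ := exists_latticePoint_combination (v := b)
    (fun i => hS.1.2 (b.mem_extremePoints_convexHull i)) hx₀ (b.sum_coord_apply_eq_one x₀)
    (by rwa [b.linear_combination_coord_eq_self])
  have hcoord : ∀ i, b.coord i (∑ j, β j • b j) = β i := fun i => by
    rw [← Finset.univ.affineCombination_eq_linear_combination _ _ hβ1]
    exact b.coord_apply_combination_of_mem (Finset.mem_univ i) hβ1
  rw [Fintype.card_fin] at hβ
  push_cast at hβ
  refine ⟨_, ⟨fun i => ?_, hβv⟩, fun i => ?_⟩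
  · rw [hcoord]
    have := sylvester_succ_sub_one_pos d
    exact lt_of_lt_of_le (by positivity) (hβ i)
  · rw [hcoord, one_div]
    exact hβ i

theorem theorem1p4 (d k : ℕ) (hd : 1 ≤ d) (hk : 1 ≤ k) :
    (∀ S ∈ latticeSimplices d k,
      ∀ b : AffineBasis (Fin (d + 1)) ℝ (Fin d → ℝ), S = convexHull ℝ (Set.range b) →
        ∃ x ∈ interior S ∩ latticePoints d,
          ∀ i : Fin (d + 1),
            1 / (((d : ℝ) + 1) * ((sylvester (d + 1) : ℝ) - 1)) ≤ b.coord i x) ∧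
    maxVolume d k ≤
      ENNReal.ofReal
        (((d : ℝ) * (2 * (d : ℝ) + 1) * ((sylvester (2 * d + 1) : ℝ) - 1)) ^ d * (k : ℝ)) := by
  refine ⟨?_, iSup₂_le fun P hP => ?_⟩
  · rintro S hS b rfl
    exact exists_coord_ge_of_mem_latticePolytopes hk b hS.1
  · obtain ⟨x, hx, hxL⟩ := nonempty_of_mem_latticePolytopes hk hP
    have hd' : (1 : ℝ) ≤ d := by exact_mod_cast hd
    have hs : (1 : ℝ) ≤ (sylvester (2 * d + 1) : ℝ) - 1 := by
      rw [sylvester_succ_sub_one]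
      exact_mod_cast one_le_prod_sylvester (2 * d)
    -- The asymmetry bound needs only the left side; the factor d is slack.
    have hN : (2 * (d : ℝ) + 1) * ((sylvester (2 * d + 1) : ℝ) - 1) ≤
        (d : ℝ) * (2 * (d : ℝ) + 1) * ((sylvester (2 * d + 1) : ℝ) - 1) := by
      rw [mul_assoc]
      exact le_mul_of_one_le_left (by positivity) hd'
    have hN1 : 1 < (d : ℝ) * (2 * (d : ℝ) + 1) * ((sylvester (2 * d + 1) : ℝ) - 1) := by
      nlinarith
    obtain ⟨w, hw, hwP⟩ := hP.1.exists_asymmetry_le hP.2.1 hx hxL hN1 hN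
    exact volume_le_of_asymmetry hP.1.convex hP.2.2 hw hN1 hwP
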